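/- Let $n\ge 2$ and let $\mathscr O=\mathscr O_{\mathbb C^n,0}$ be the ring of germs at $0$ of holomorphic functions on $\mathbb C^n$ with coordinates $x_1,\dots,x_n$. For $f\in\mathscr O$ let $T(f)=\left(f,\frac{\partial f}{\partial x_1},\dots,\frac{\partial f}{\partial x_n}\right)$; an ideal $I\subseteq\mathscr O$ is a \emph{Tjurina ideal} if $I=T(f)$ for some $f\in\mathscr O$. For an ideal $J=(g_1,\dots,g_q)$ put $T(J)=T(g_1)+\dots+T(g_q)$ (this does not depend on the generators), and for an ideal $I$ let $\Delta(I)=\{f\in\mathscr O : T(f)\subseteq I\}$, which is an ideal. The ideal $I$ is \emph{$T$-full} if $I=T(\Delta(I))$. The \emph{multiplicity} of a non-zero $f\in\mathscr O$ is the smallest degree of a non-zero homogeneous part of its Taylor expansion at $0$. (i) If $I=(f^k)$ with $f\in\mathscr O$ irreducible and $k\ge 1$, then $I$ is a Tjurina ideal if and only if $f$ has multiplicity one. (ii) If $I=(f)$ with $f=f_1^{k_1}\cdots f_r^{k_r}$, where $r\ge 2$, all $k_i\ge 1$, and $f_1,\dots,f_r\in\mathscr O$ are irreducible and pairwise non-associated,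 then $I$ is not a Tjurina ideal. (iii) A principal ideal $I\subseteq\mathscr O$ is a Tjurina ideal if and only if it is $T$-full. -/

import Mathlib

open Filter Topology

noncomputable section

namespace TjurinaIdeals

/-- The ring of germs at the origin of holomorphic functions on `ℂⁿ`: those germs of functions at
`0` that have a representative which is complex analytic at `0`. -/
def HolGerm (n : ℕ) : Subring (Germ (𝓝 (0 : Fin n → ℂ)) ℂ) where
  carrier := {φ | ∃ f : (Fin n → ℂ) → ℂ, AnalyticAt ℂ f 0 ∧ Germ.ofFun f = φ}
  mul_mem' := by
    rintro _ _ ⟨f, hf, rfl⟩ ⟨g, hg, rfl⟩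
    exact ⟨f * g, hf.mul hg, rfl⟩
  one_mem' := ⟨fun _ => 1, analyticAt_const, rfl⟩
  add_mem' := by
    rintro _ _ ⟨f, hf, rfl⟩ ⟨g, hg, rfl⟩
    exact ⟨f + g, hf.add hg, rfl⟩
  zero_mem' := ⟨fun _ => 0, analyticAt_const, rfl⟩
  neg_mem' := by
    rintro _ ⟨f, hf, rfl⟩
    exact ⟨-f, hf.neg, rfl⟩

variable {n : ℕ}

/-- `∂f/∂x_i` for a function `f` on `ℂⁿ`. -/
def partialFun (i : Fin n) (f : (Fin n → ℂ) → ℂ) : (Fin n → ℂ) → ℂ :=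
  fun x => fderiv ℂ f x (Pi.single i 1)

/-- The germ of `∂f/∂x_i`, as a function of the germ of `f`. -/
def germPartial (i : Fin n) : Germ (𝓝 (0 : Fin n → ℂ)) ℂ → Germ (𝓝 (0 : Fin n → ℂ)) ℂ :=
  Germ.map' (partialFun i) fun _ _ h =>
    (EventuallyEq.fderiv (𝕜 := ℂ) h).mono fun x hx => by simp only [partialFun, hx]

theorem germPartial_coe (i : Fin n) (f : (Fin n → ℂ) → ℂ) :
    germPartial i (Germ.ofFun f) = Germ.ofFun (partialFun i f) := rfl

/-- The partial derivative `∂/∂x_i` on the ring of germs of holomorphic functions. -/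
def pderiv (i : Fin n) (φ : HolGerm n) : HolGerm n :=
  ⟨germPartial i φ.1, by
    obtain ⟨_, ⟨f, hf, rfl⟩⟩ := φ
    exact ⟨partialFun i f,
      (ContinuousLinearMap.apply ℂ ℂ (Pi.single i (1 : ℂ) : Fin n → ℂ)).analyticAt _ |>.comp
        hf.fderiv, rfl⟩⟩

theorem pderiv_zero (i : Fin n) : pderiv i (0 : HolGerm n) = 0 := by
  apply Subtype.ext
  change germPartial i (Germ.ofFun fun _ => 0) = Germ.ofFun fun _ => 0
  rw [germPartial_coe]
  congr 1
  funext x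
  simp [partialFun]

theorem pderiv_add (i : Fin n) (φ ψ : HolGerm n) :
    pderiv i (φ + ψ) = pderiv i φ + pderiv i ψ := by
  obtain ⟨_, ⟨f, hf, rfl⟩⟩ := φ
  obtain ⟨_, g, hg, rfl⟩ := ψ
  apply Subtype.ext
  change Germ.ofFun (partialFun i (f + g)) =
    Germ.ofFun (partialFun i f + partialFun i g)
  refine Germ.coe_eq.2 ?_
  filter_upwards [hf.eventually_analyticAt, hg.eventually_analyticAt] with x hfx hgx
  simp [partialFun, fderiv_add hfx.differentiableAt hgx.differentiableAt]

theorem pderiv_mul (i : Fin n) (φ ψ : HolGerm n) :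
    pderiv i (φ * ψ) = φ * pderiv i ψ + ψ * pderiv i φ := by
  obtain ⟨_, ⟨f, hf, rfl⟩⟩ := φ
  obtain ⟨_, g, hg, rfl⟩ := ψ
  apply Subtype.ext
  change Germ.ofFun (partialFun i (f * g)) =
    Germ.ofFun (f * partialFun i g + g * partialFun i f)
  refine Germ.coe_eq.2 ?_
  filter_upwards [hf.eventually_analyticAt, hg.eventually_analyticAt] with x hfx hgx
  simp [partialFun, fderiv_mul hfx.differentiableAt hgx.differentiableAt]

/-- The degree `m` homogeneous part `y ↦ D^m f(0)(y, …, y) / m!` of the Taylor expansion at `0`. -/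
def homogPart (m : ℕ) (φ : HolGerm n) : (Fin n → ℂ) → ℂ :=
  Quotient.liftOn' φ.1
    (fun f y => ((m.factorial : ℂ))⁻¹ * iteratedFDeriv ℂ m f 0 (fun _ => y))
    (fun _ _ h => by
      funext y
      rw [(EventuallyEq.iteratedFDeriv ℂ h m).eq_of_nhds])

/-- The multiplicity of a germ: the smallest degree `m` in which the Taylor expansion at `0` has a
non-zero homogeneous part (`⊤` for the zero germ). -/
def mult (φ : HolGerm n) : ℕ∞ :=
  ⨅ (m : ℕ) (_ : homogPart m φ ≠ 0), (m : ℕ∞)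

/-- The Tjurina ideal `T(f) = (f, ∂f/∂x_1, …, ∂f/∂x_n)` of a germ. -/
def tjurina (f : HolGerm n) : Ideal (HolGerm n) :=
  Ideal.span (insert f (Set.range fun i => pderiv i f))

theorem tjurina_le_iff (f : HolGerm n) (I : Ideal (HolGerm n)) :
    tjurina f ≤ I ↔ f ∈ I ∧ ∀ i, pderiv i f ∈ I := by
  simp [tjurina, Ideal.span_le, Set.insert_subset_iff, Set.range_subset_iff]

/-- The ideal of antiderivatives `Δ(I) = {f | T(f) ⊆ I}`. -/
def antideriv (I : Ideal (HolGerm n)) : Ideal (HolGerm n) where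
  carrier := {f | tjurina f ≤ I}
  zero_mem' := (tjurina_le_iff _ _).2
    ⟨I.zero_mem, fun i => by rw [pderiv_zero]; exact I.zero_mem⟩
  add_mem' := by
    intro a b ha hb
    have ha' := (tjurina_le_iff _ _).1 ha
    have hb' := (tjurina_le_iff _ _).1 hb
    exact (tjurina_le_iff _ _).2 ⟨I.add_mem ha'.1 hb'.1, fun i => by
      rw [pderiv_add]; exact I.add_mem (ha'.2 i) (hb'.2 i)⟩
  smul_mem' := by
    intro c a ha
    have ha' := (tjurina_le_iff _ _).1 ha
    exact (tjurina_le_iff _ _).2 ⟨I.mul_mem_left c ha'.1, fun i => by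
      rw [smul_eq_mul, pderiv_mul]
      exact I.add_mem (I.mul_mem_left c (ha'.2 i)) (I.mul_mem_right _ ha'.1)⟩

/-- The Tjurina ideal `T(J)` of an ideal `J`, the sum of the ideals `T(g)` for `g ∈ J`. By
`tjurinaOfIdeal_span` it is `T(g_1) + ⋯ + T(g_q)` for any generators `g_1, …, g_q` of `J`. -/
def tjurinaOfIdeal (J : Ideal (HolGerm n)) : Ideal (HolGerm n) :=
  ⨆ g ∈ J, tjurina g

theorem tjurinaOfIdeal_span (S : Set (HolGerm n)) :
    tjurinaOfIdeal (Ideal.span S) = ⨆ g ∈ S, tjurina g := by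
  apply le_antisymm
  · have h : Ideal.span S ≤ antideriv (⨆ g ∈ S, tjurina g) :=
      Ideal.span_le.2 fun g hg => le_iSup₂_of_le (f := fun g (_ : g ∈ S) => tjurina g) g hg le_rfl
    exact iSup₂_le fun g hg => h hg
  · exact iSup₂_le fun g hg =>
      le_iSup₂_of_le (f := fun g (_ : g ∈ Ideal.span S) => tjurina g) g
        (Ideal.subset_span hg) le_rfl

/-- `I` is a Tjurina ideal: `I = T(f)` for some germ `f`. -/
def IsTjurinaIdeal (I : Ideal (HolGerm n)) : Prop :=
  ∃ f : HolGerm n, I = tjurina f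

/-- `I` is `T`-full: `I = T(Δ(I))`. -/
def IsTFull (I : Ideal (HolGerm n)) : Prop :=
  I = tjurinaOfIdeal (antideriv I)

end TjurinaIdeals

end

/-!
The ring `HolGerm n` is a local domain: a germ is a unit exactly when its value at the origin is
nonzero, and the identity theorem excludes zero divisors. It is filtered by the ideals `vanishing k`
of germs of multiplicity at least `k`. These satisfy `V_j V_k ⊆ V_{j+k}`, each partial derivative
maps `V_{k+1}` into `V_k`, and their intersection is zero. Hence a nonzero germ that divides all of
its partial derivatives is a unit (`isUnit_of_dvd_pderiv`).

Suppose that `(h) = T(g)` with `h` neither zero nor a unit. Since the ring is local, `(h)` is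
generated by one of the generators of `T(g)`. It is not generated by `g`, which would then divide
all of its derivatives, so it is generated by some `p = ∂g/∂x_i`. Write `g = a p` with `a` a
nonunit. Comparing multiplicities in `p = ∂(a p)/∂x_i` shows that `a` has multiplicity one, so that
`a` is prime (`prime_of_isUnit_pderiv`). Write `p = a^s q` with `a ∤ q`. As `p` divides every
derivative of `a^{s+1} q`, there is a relation `a ∂_j q = q c_j` for each `j`; primality gives
`a ∣ c_j`, hence `q ∣ ∂_j q`, and `q` is a unit. So `h` is a power of `a` up to a unit
(`exists_associated_pow_of_span_eq_tjurina`). Every irreducible factor of `h` is therefore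
associated to `a`, which excludes two non-associated factors and forces multiplicity one.
Conversely `T(a^{k+1}) = (a^k)` as soon as some `∂a/∂x_i` is a unit. No unique factorization in
`HolGerm n` is needed beyond the primality of germs of multiplicity one.

That primality comes from the inverse function theorem, which turns `a` into the coordinate `x_i`,
together with Hadamard's division lemma `f - f|_{x_i = 0} = x_i g`, proved on the level of power
series (`exists_coord_mul_eq_sub_dropCoord`): `x_i` divides exactly the germs vanishing on the
hyperplane, and restriction to a hyperplane is multiplicative.

If `I` is principal and `I = T(Δ(I))`, the members of the ideals `T(g)` with `g ∈ Δ(I)` generate `I`.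
By locality one of them, lying in `T(g)` say, generates `I`, so that `I ⊆ T(g) ⊆ I`. The other
direction holds for every ideal.
-/

open Filter Topology

noncomputable section

namespace TjurinaIdeals

variable {n : ℕ}

/-! ### The local domain of holomorphic germs -/

/-- The germ of a function that is analytic at the origin. -/
def HolGerm.mk (f : (Fin n → ℂ) → ℂ) (hf : AnalyticAt ℂ f 0) : HolGerm n :=
  ⟨Germ.ofFun f, f, hf, rfl⟩

theorem HolGerm.exists_rep (φ : HolGerm n) : ∃ f hf, φ = HolGerm.mk f hf := by
  obtain ⟨_, f, hf, rfl⟩ := φ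
  exact ⟨f, hf, rfl⟩

theorem HolGerm.mk_eq_mk {f g : (Fin n → ℂ) → ℂ} {hf : AnalyticAt ℂ f 0}
    {hg : AnalyticAt ℂ g 0} : HolGerm.mk f hf = HolGerm.mk g hg ↔ f =ᶠ[𝓝 0] g :=
  Subtype.ext_iff.trans Germ.coe_eq

theorem HolGerm.mk_eq_zero {f : (Fin n → ℂ) → ℂ} {hf : AnalyticAt ℂ f 0} :
    HolGerm.mk f hf = 0 ↔ f =ᶠ[𝓝 0] fun _ => 0 :=
  HolGerm.mk_eq_mk (hg := analyticAt_const)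

theorem HolGerm.mk_mul_mk {f g : (Fin n → ℂ) → ℂ} (hf : AnalyticAt ℂ f 0)
    (hg : AnalyticAt ℂ g 0) :
    HolGerm.mk f hf * HolGerm.mk g hg = HolGerm.mk (f * g) (hf.mul hg) :=
  rfl

/-- The value of a germ at the origin, as a ring homomorphism. -/
def evalZero : HolGerm n →+* ℂ :=
  Germ.valueRingHom.comp (HolGerm n).subtype

theorem evalZero_mk {f : (Fin n → ℂ) → ℂ} (hf : AnalyticAt ℂ f 0) :
    evalZero (HolGerm.mk f hf) = f 0 :=
  rfl

theorem isUnit_iff_evalZero_ne_zero {φ : HolGerm n} : IsUnit φ ↔ evalZero φ ≠ 0 := by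
  refine ⟨fun h => (h.map evalZero).ne_zero, fun h => ?_⟩
  obtain ⟨f, hf, rfl⟩ := HolGerm.exists_rep φ
  rw [evalZero_mk] at h
  refine IsUnit.of_mul_eq_one (HolGerm.mk f⁻¹ (hf.inv h)) ?_
  rw [HolGerm.mk_mul_mk]
  refine (HolGerm.mk_eq_mk (hg := analyticAt_const)).2 ?_
  filter_upwards [hf.continuousAt.eventually_ne h] with x hx
  simp [hx]

instance : Nontrivial (HolGerm n) :=
  evalZero.domain_nontrivial

instance : IsLocalRing (HolGerm n) :=
  .of_isUnit_or_isUnit_one_sub_self fun φ => by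
    simp only [isUnit_iff_evalZero_ne_zero, map_sub, map_one]
    by_cases h : evalZero φ = 0 <;> simp [h]

instance : NoZeroDivisors (HolGerm n) where
  eq_zero_or_eq_zero_of_mul_eq_zero {φ ψ} h := by
    obtain ⟨f, hf, rfl⟩ := HolGerm.exists_rep φ
    obtain ⟨g, hg, rfl⟩ := HolGerm.exists_rep ψ
    rw [HolGerm.mk_mul_mk, HolGerm.mk_eq_zero] at h
    obtain ⟨ε, hε, hball⟩ := Metric.eventually_nhds_iff_ball.1
      ((hf.eventually_analyticAt.and hg.eventually_analyticAt).and h)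
    by_cases hf0 : ∀ x ∈ Metric.ball (0 : Fin n → ℂ) ε, f x = 0
    · exact Or.inl (HolGerm.mk_eq_zero.2
        (Filter.eventually_of_mem (Metric.ball_mem_nhds 0 hε) hf0))
    · push Not at hf0
      obtain ⟨x, hx, hfx⟩ := hf0
      -- `f` is nonzero near `x`, so `g` vanishes near `x`, hence on the whole ball.
      have hg0 : g =ᶠ[𝓝 x] 0 := by
        filter_upwards [(hball x hx).1.1.continuousAt.eventually_ne hfx,
          Metric.isOpen_ball.mem_nhds hx] with y hy hyb
        exact (mul_eq_zero.1 (hball y hyb).2).resolve_left hy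
      have hg' : AnalyticOnNhd ℂ g (Metric.ball 0 ε) := fun y hy => (hball y hy).1.2
      have := hg'.eqOn_zero_of_preconnected_of_eventuallyEq_zero
        (convex_ball (0 : Fin n → ℂ) ε).isPreconnected hx hg0
      exact Or.inr (HolGerm.mk_eq_zero.2
        (Filter.eventually_of_mem (Metric.ball_mem_nhds 0 hε) this))

instance : IsDomain (HolGerm n) :=
  NoZeroDivisors.to_isDomain _

/-- In a local domain, a nonzero principal ideal is generated by a member of any of its
generating sets: otherwise it would be contained in its product with the maximal ideal. -/
theorem exists_mem_span_singleton_eq {R : Type*} [CommRing R] [IsDomain R] [IsLocalRing R]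
    {S : Set R} {h : R} (h0 : h ≠ 0) (hS : Ideal.span S = Ideal.span {h}) :
    ∃ s ∈ S, Ideal.span {s} = Ideal.span {h} := by
  by_contra! hne
  have hle : Ideal.span S ≤ Ideal.span {h} * IsLocalRing.maximalIdeal R := by
    refine Ideal.span_le.2 fun s hs => ?_
    obtain ⟨c, rfl⟩ := Ideal.mem_span_singleton.1 (hS ▸ Ideal.subset_span hs : s ∈ Ideal.span {h})
    refine Ideal.mul_mem_mul (Ideal.mem_span_singleton_self h) ?_
    rw [IsLocalRing.mem_maximalIdeal]
    intro hc
    exact hne _ hs (Ideal.span_singleton_mul_right_unit hc h)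
  obtain ⟨c, hc, hch⟩ := Ideal.mem_span_singleton_mul.1
    (hle (hS ▸ Ideal.mem_span_singleton_self h))
  rw [mul_eq_left₀ h0] at hch
  exact (Ideal.ne_top_iff_one _).1 (IsLocalRing.maximalIdeal.isMaximal R).ne_top (hch ▸ hc)

theorem pderiv_mk (i : Fin n) {f : (Fin n → ℂ) → ℂ} (hf : AnalyticAt ℂ f 0) :
    ∃ h, pderiv i (HolGerm.mk f hf) = HolGerm.mk (partialFun i f) h :=
  ⟨(ContinuousLinearMap.apply ℂ ℂ (Pi.single i (1 : ℂ) : Fin n → ℂ)).analyticAt _ |>.comp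
        hf.fderiv, rfl⟩

theorem pderiv_pow_succ (i : Fin n) (φ : HolGerm n) (k : ℕ) :
    pderiv i (φ ^ (k + 1)) = φ ^ k * ((k + 1) * pderiv i φ) := by
  induction k with
  | zero => simp
  | succ k ih => rw [pow_succ, pderiv_mul, ih]; push_cast; ring

/-! ### The order filtration -/

/-- The ideal of germs whose iterated partial derivatives of order less than `k` all vanish at the
origin, i.e. of germs of multiplicity at least `k`. -/
def vanishing : ℕ → Ideal (HolGerm n)
  | 0 => ⊤
  | k + 1 => antideriv (vanishing k) ⊓ RingHom.ker evalZero

theorem mem_vanishing_succ {k : ℕ} {φ : HolGerm n} :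
    φ ∈ vanishing (k + 1) ↔
      (φ ∈ vanishing k ∧ ∀ i, pderiv i φ ∈ vanishing k) ∧ evalZero φ = 0 := by
  rw [← tjurina_le_iff]
  rfl

theorem mem_vanishing_one {φ : HolGerm n} : φ ∈ vanishing 1 ↔ evalZero φ = 0 := by
  rw [← zero_add 1, mem_vanishing_succ]
  simp [vanishing]

theorem mul_mem_vanishing {j k : ℕ} {φ ψ : HolGerm n} (hφ : φ ∈ vanishing j)
    (hψ : ψ ∈ vanishing k) : φ * ψ ∈ vanishing (j + k) := by
  induction hN : j + k generalizing j k φ ψ with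
  | zero => trivial
  | succ N ih =>
    match j, k with
    | 0, k => exact hN ▸ Ideal.mul_mem_left _ _ (by simpa using hψ)
    | j + 1, 0 => exact hN ▸ Ideal.mul_mem_right _ _ (by simpa using hφ)
    | j + 1, k + 1 =>
      have hφ' := mem_vanishing_succ.1 hφ
      have hψ' := mem_vanishing_succ.1 hψ
      refine mem_vanishing_succ.2 ⟨⟨ih hφ hψ'.1.1 (by omega), fun i => ?_⟩, by simp [hφ'.2]⟩
      rw [pderiv_mul]
      exact add_mem (ih hφ (hψ'.1.2 i) (by omega)) (ih hψ (hφ'.1.2 i) (by omega))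

theorem pow_mem_vanishing {φ : HolGerm n} (hφ : evalZero φ = 0) (k : ℕ) :
    φ ^ k ∈ vanishing k := by
  induction k with
  | zero => trivial
  | succ k ih => exact pow_succ φ k ▸ mul_mem_vanishing ih (mem_vanishing_one.2 hφ)

theorem iteratedFDeriv_eq_zero_of_mem_vanishing {k : ℕ} {f : (Fin n → ℂ) → ℂ}
    (hf : AnalyticAt ℂ f 0) (h : HolGerm.mk f hf ∈ vanishing (k + 1)) :
    iteratedFDeriv ℂ k f 0 = 0 := by
  induction k generalizing f with
  | zero =>
    ext v
    simpa using (evalZero_mk hf).symm.trans (mem_vanishing_one.1 h)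
  | succ k ih =>
    ext v
    have key : ∀ i, iteratedFDeriv ℂ k (fderiv ℂ f) 0 (Fin.init v) (Pi.single i 1) = 0 := by
      intro i
      obtain ⟨hi, hpd⟩ := pderiv_mk i hf
      have h0 := ih hi (hpd ▸ (mem_vanishing_succ.1 h).1.2 i)
      have h1 := (ContinuousLinearMap.apply ℂ ℂ
        (Pi.single i (1 : ℂ) : Fin n → ℂ)).iteratedFDeriv_comp_left
        (f := fderiv ℂ f) (x := 0) (n := ⊤) (i := k) hf.fderiv.contDiffAt (by simp)
      have h2 : iteratedFDeriv ℂ k (partialFun i f) 0 (Fin.init v) = 0 := by rw [h0]; rfl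
      exact (congrArg (· (Fin.init v)) h1).symm.trans h2
    rw [iteratedFDeriv_succ_apply_right, pi_eq_sum_univ' (v (Fin.last k)), map_sum]
    exact Finset.sum_eq_zero fun i _ => by rw [map_smul, key, smul_zero]

/-- A germ whose Taylor expansion vanishes is zero. -/
theorem eq_zero_of_forall_mem_vanishing {φ : HolGerm n} (h : ∀ k, φ ∈ vanishing k) : φ = 0 := by
  obtain ⟨f, hf, rfl⟩ := HolGerm.exists_rep φ
  have hzero : ∀ k, iteratedFDeriv ℂ k f 0 = 0 := fun k =>
    iteratedFDeriv_eq_zero_of_mem_vanishing hf (h (k + 1))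
  obtain ⟨p, r, hp⟩ := id hf
  refine HolGerm.mk_eq_zero.2 ?_
  filter_upwards [Metric.eball_mem_nhds 0 hp.r_pos] with y hy
  have hs := hp.hasSum_iteratedFDeriv hy
  have h0 : (fun k => ((k.factorial : ℂ))⁻¹ • iteratedFDeriv ℂ k f 0 fun _ => y) = fun _ => 0 :=
    funext fun k => by rw [hzero k, zero_apply, smul_zero]
  rw [h0, zero_add] at hs
  exact hs.unique hasSum_zero

theorem finiteMultiplicity_of_evalZero_eq_zero {a φ : HolGerm n} (ha : evalZero a = 0) (hφ : φ ≠ 0) :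
    FiniteMultiplicity a φ := by
  by_contra h
  refine hφ (eq_zero_of_forall_mem_vanishing fun k => ?_)
  exact Ideal.mem_of_dvd _ (FiniteMultiplicity.not_iff_forall.1 h k) (pow_mem_vanishing ha k)

/-- A nonzero germ dividing all of its partial derivatives is a unit, because differentiation
lowers the multiplicity of a nonunit. -/
theorem isUnit_of_dvd_pderiv {φ : HolGerm n} (h0 : φ ≠ 0) (h : ∀ i, φ ∣ pderiv i φ) :
    IsUnit φ := by
  by_contra hu
  rw [isUnit_iff_evalZero_ne_zero, not_not] at hu
  refine h0 (eq_zero_of_forall_mem_vanishing fun k => ?_)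
  induction k with
  | zero => trivial
  | succ k ih => exact mem_vanishing_succ.2 ⟨⟨ih, fun i => Ideal.mem_of_dvd _ (h i) ih⟩, hu⟩

/-- Multiplicity one means vanishing at the origin with nonvanishing linear part. -/
theorem mult_eq_one_iff {φ : HolGerm n} :
    mult φ = 1 ↔ evalZero φ = 0 ∧ ∃ i, IsUnit (pderiv i φ) := by
  obtain ⟨f, hf, rfl⟩ := HolGerm.exists_rep φ
  have h0 : homogPart 0 (HolGerm.mk f hf) = fun _ => f 0 := by
    funext y
    change ((Nat.factorial 0 : ℕ) : ℂ)⁻¹ * iteratedFDeriv ℂ 0 f 0 (fun _ => y) = f 0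
    simp
  have h1 : homogPart 1 (HolGerm.mk f hf) = fderiv ℂ f 0 := by
    funext y
    change ((Nat.factorial 1 : ℕ) : ℂ)⁻¹ * iteratedFDeriv ℂ 1 f 0 (fun _ => y) = _
    simp
  have h0' : homogPart 0 (HolGerm.mk f hf) ≠ 0 ↔ f 0 ≠ 0 := by
    rw [h0, Function.ne_iff]; simp
  have h1' : homogPart 1 (HolGerm.mk f hf) ≠ 0 ↔ ∃ i, IsUnit (pderiv i (HolGerm.mk f hf)) := by
    rw [← not_iff_not, not_not, not_exists, h1]
    have hpd : ∀ i, ¬ IsUnit (pderiv i (HolGerm.mk f hf)) ↔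
        fderiv ℂ f 0 (Pi.single i 1) = 0 := fun i => by
      obtain ⟨hi, h⟩ := pderiv_mk i hf
      rw [isUnit_iff_evalZero_ne_zero, not_not, h, evalZero_mk]
      rfl
    simp only [hpd]
    refine ⟨fun h i => congrFun h _, fun h => funext fun y => ?_⟩
    rw [pi_eq_sum_univ' y, map_sum]
    exact Finset.sum_eq_zero fun i _ => by rw [map_smul, h, smul_zero]
  have hle : ∀ m, homogPart m (HolGerm.mk f hf) ≠ 0 → mult (HolGerm.mk f hf) ≤ m :=
    fun m hm => iInf₂_le m hm
  rw [← h1', evalZero_mk]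
  constructor
  · intro h
    have hf0 : f 0 = 0 := by
      by_contra hne
      simpa [h] using hle 0 (h0'.2 hne)
    refine ⟨hf0, fun h10 => ?_⟩
    have h2 : (2 : ℕ∞) ≤ mult (HolGerm.mk f hf) := by
      refine le_iInf₂ fun m hm => ?_
      match m with
      | 0 => exact absurd hf0 (h0'.1 hm)
      | 1 => exact absurd h10 hm
      | m + 2 => exact_mod_cast Nat.le_add_left 2 m
    rw [h] at h2
    exact absurd h2 (by decide)
  · rintro ⟨hf0, h10⟩
    refine le_antisymm (hle 1 h10) (le_iInf₂ fun m hm => ?_)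
    match m with
    | 0 => exact absurd hf0 (h0'.1 hm)
    | m + 1 => exact_mod_cast Nat.le_add_left 1 m

/-! ### Division by a germ of multiplicity one -/

/-- The coordinate projection of `ℂⁿ` onto the hyperplane `x_i = 0`. -/
def dropCoord (i : Fin n) : (Fin n → ℂ) →L[ℂ] (Fin n → ℂ) :=
  ContinuousLinearMap.pi fun j => if j = i then 0 else ContinuousLinearMap.proj j

theorem dropCoord_self (i : Fin n) (x : Fin n → ℂ) : dropCoord i x i = 0 := by
  simp [dropCoord]

theorem dropCoord_of_ne {i j : Fin n} (h : j ≠ i) (x : Fin n → ℂ) : dropCoord i x j = x j := by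
  simp [dropCoord, h]

theorem sub_dropCoord (i : Fin n) (x : Fin n → ℂ) : x - dropCoord i x = x i • Pi.single i 1 := by
  ext j
  by_cases h : j = i
  · subst h; simp [dropCoord_self]
  · simp [dropCoord_of_ne h, h]

theorem norm_dropCoord_le (i : Fin n) : ‖dropCoord i‖ ≤ 1 := by
  refine ContinuousLinearMap.opNorm_le_bound _ zero_le_one fun x => ?_
  rw [one_mul, pi_norm_le_iff_of_nonneg (norm_nonneg x)]
  intro j
  by_cases h : j = i
  · subst h; simp [dropCoord_self]
  · simpa [dropCoord_of_ne h] using norm_le_pi_norm x j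

/-- The summands of `divCoordSeries`: the degree `m + 1` term of `p` with its `k`-th argument
replaced by the `i`-th basis vector and the later ones by their projections to `x_i = 0`. -/
def divCoordTerm (i : Fin n) (p : FormalMultilinearSeries ℂ (Fin n → ℂ) ℂ) (m : ℕ)
    (k : Fin (m + 1)) : ContinuousMultilinearMap ℂ (fun _ : Fin m => Fin n → ℂ) ℂ :=
  ((p (m + 1)).curryMid k (Pi.single i 1) :
    ContinuousMultilinearMap ℂ (fun _ : Fin m => Fin n → ℂ) ℂ).compContinuousLinearMap
      (fun l => if l.castSucc < k then ContinuousLinearMap.id ℂ _ else dropCoord i)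

/-- The power series of `(f - f ∘ π) / x_i`, where `p` is a power series of `f` at the origin and
`π` the projection onto `x_i = 0`. Summing over the position `k` of the distinguished argument makes
`p(x, …, x) - p(πx, …, πx)` telescope. -/
def divCoordSeries (i : Fin n) (p : FormalMultilinearSeries ℂ (Fin n → ℂ) ℂ) :
    FormalMultilinearSeries ℂ (Fin n → ℂ) ℂ := fun m =>
  ∑ k : Fin (m + 1), divCoordTerm i p m k

theorem norm_divCoordTerm_le (i : Fin n) (p : FormalMultilinearSeries ℂ (Fin n → ℂ) ℂ)
    (m : ℕ) (k : Fin (m + 1)) : ‖divCoordTerm i p m k‖ ≤ ‖p (m + 1)‖ := by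
  refine (ContinuousMultilinearMap.norm_compContinuousLinearMap_le _ _).trans ?_
  refine (mul_le_of_le_one_right (norm_nonneg _)
    (Finset.prod_le_one (fun _ _ => norm_nonneg _) fun l _ => ?_)).trans ?_
  · split_ifs
    · exact ContinuousLinearMap.norm_id_le
    · exact norm_dropCoord_le i
  · have h := ((p (m + 1)).curryMid k).le_opNorm (Pi.single i (1 : ℂ))
    rwa [ContinuousMultilinearMap.norm_curryMid, Pi.norm_single, norm_one, mul_one] at h

theorem norm_divCoordSeries_le (i : Fin n) (p : FormalMultilinearSeries ℂ (Fin n → ℂ) ℂ)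
    (m : ℕ) : ‖divCoordSeries i p m‖ ≤ (m + 1) * ‖p (m + 1)‖ := by
  have h := norm_sum_le_of_le Finset.univ fun k _ => norm_divCoordTerm_le i p m k
  rw [Finset.sum_const, Finset.card_univ, Fintype.card_fin, nsmul_eq_mul] at h
  exact_mod_cast h

theorem coord_mul_divCoordSeries (i : Fin n) (p : FormalMultilinearSeries ℂ (Fin n → ℂ) ℂ)
    (m : ℕ) (x : Fin n → ℂ) :
    x i * divCoordSeries i p m (fun _ => x) =
      p (m + 1) (fun _ => x) - p (m + 1) (fun _ => dropCoord i x) := by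
  set u : ℕ → Fin (m + 1) → Fin n → ℂ :=
    fun k l => if (l : ℕ) < k then x else dropCoord i x with hu
  have step : ∀ k : Fin (m + 1),
      x i * divCoordTerm i p m k (fun _ => x) = p (m + 1) (u (k + 1)) - p (m + 1) (u k) := by
    intro k
    have h1 : u (k + 1) = Function.update (u k) k x := by
      ext1 l
      by_cases h : l = k
      · subst h; simp [hu]
      · have : (l : ℕ) ≠ k := fun h' => h (Fin.ext h')
        simp only [hu, Function.update_of_ne h]
        congr 1
        exact propext (by omega)
    have h2 : u k = Function.update (u k) k (dropCoord i x) := by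
      ext1 l
      by_cases h : l = k
      · subst h; simp [hu]
      · rw [Function.update_of_ne h]
    have h3 : k.insertNth (Pi.single i 1) (fun l : Fin m =>
        (if l.castSucc < k then ContinuousLinearMap.id ℂ (Fin n → ℂ) else dropCoord i) x)
        = Function.update (u k) k (Pi.single i 1) := by
      ext1 l
      refine Fin.succAboveCases k ?_ (fun l => ?_) l
      · simp
      · rw [Fin.insertNth_apply_succAbove, Function.update_of_ne (Fin.succAbove_ne k l)]
        by_cases h : l.castSucc < k
        · have : (l : ℕ) < k := h
          simp [hu, Fin.succAbove_of_castSucc_lt _ _ h, h, this]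
        · have h' : ¬ (l : ℕ) < k := h
          have : ¬ (l : ℕ) + 1 < k := by omega
          simp [hu, Fin.succAbove_of_le_castSucc _ _ (not_lt.1 h), h, this]
    rw [divCoordTerm, ContinuousMultilinearMap.compContinuousLinearMap_apply,
      ContinuousMultilinearMap.curryMid_apply, h3, h1]
    conv_rhs => rw [h2]
    rw [Function.update_idem, ← ContinuousMultilinearMap.map_update_sub, sub_dropCoord,
      ContinuousMultilinearMap.map_update_smul, smul_eq_mul]
  rw [divCoordSeries, sum_apply, Finset.mul_sum,
    Finset.sum_congr rfl fun k _ => step k,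
    Fin.sum_univ_eq_sum_range (fun k => p (m + 1) (u (k + 1)) - p (m + 1) (u k)),
    Finset.sum_range_sub (fun k => p (m + 1) (u k))]
  congr 2
  ext1 l
  simp [hu, show ¬ m < (l : ℕ) by omega]

theorem radius_divCoordSeries_pos (i : Fin n) {p : FormalMultilinearSeries ℂ (Fin n → ℂ) ℂ}
    (hp : 0 < p.radius) : 0 < (divCoordSeries i p).radius := by
  obtain ⟨r, hr0, hr⟩ := ENNReal.lt_iff_exists_nnreal_btwn.1 hp
  have hr0' : 0 < r := by exact_mod_cast hr0
  obtain ⟨C, hC, hCr⟩ := p.norm_mul_pow_le_of_lt_radius hr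
  have hle : ((r / 2 : NNReal) : ENNReal) ≤ (divCoordSeries i p).radius := by
    refine FormalMultilinearSeries.le_radius_of_bound _ (C / r) fun m => ?_
    have hr' : (0 : ℝ) < r := hr0'
    have h2 : ((m : ℝ) + 1) ≤ 2 ^ m := by exact_mod_cast Nat.lt_two_pow_self (n := m)
    push_cast
    rw [div_pow, le_div_iff₀ hr']
    calc ‖divCoordSeries i p m‖ * ((r : ℝ) ^ m / 2 ^ m) * r
        ≤ ((m + 1) * ‖p (m + 1)‖) * ((r : ℝ) ^ m / 2 ^ m) * r := by
          gcongr; exact norm_divCoordSeries_le i p m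
      _ = ((m + 1) / 2 ^ m) * (‖p (m + 1)‖ * r ^ (m + 1)) := by ring
      _ ≤ 1 * C := by
          gcongr
          · exact (div_le_one (by positivity)).2 h2
          · exact hCr _
      _ = C := one_mul C
  refine lt_of_lt_of_le ?_ hle
  exact_mod_cast half_pos hr0'

/-- Hadamard's division lemma for analytic functions. -/
theorem exists_coord_mul_eq_sub_dropCoord (i : Fin n) {f : (Fin n → ℂ) → ℂ}
    (hf : AnalyticAt ℂ f 0) :
    ∃ g, AnalyticAt ℂ g 0 ∧ ∀ᶠ x in 𝓝 0, f x - f (dropCoord i x) = x i * g x := by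
  obtain ⟨p, r, hp⟩ := hf
  have hq := (divCoordSeries i p).hasFPowerSeriesOnBall
    (radius_divCoordSeries_pos i (hp.r_pos.trans_le hp.r_le))
  refine ⟨_, hq.analyticAt, ?_⟩
  have hπ : Tendsto (dropCoord i) (𝓝 0) (𝓝 0) := by
    simpa using (dropCoord i).continuous.tendsto 0
  have hball := Metric.eball_mem_nhds (0 : Fin n → ℂ) hp.r_pos
  filter_upwards [hball, hπ hball, Metric.eball_mem_nhds 0 hq.r_pos] with x hx hx' hxq
  have h1 := (hp.hasSum hx).sub (hp.hasSum hx')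
  have h2 := (hq.hasSum hxq).mul_left (x i)
  simp only [zero_add, coord_mul_divCoordSeries] at h1 h2
  rw [← hasSum_nat_add_iff' 1] at h1
  have h0 : p 0 (fun _ => x) = p 0 (fun _ => dropCoord i x) :=
    congrArg (p 0) (Subsingleton.elim _ _)
  simp only [Finset.sum_range_one, h0, sub_self, sub_zero] at h1
  exact h1.unique h2

/-- A germ of multiplicity one is, up to a local biholomorphism, a coordinate function. -/
theorem exists_local_coordinates {a : (Fin n → ℂ) → ℂ} (ha : AnalyticAt ℂ a 0) (ha0 : a 0 = 0)
    {i : Fin n} (hi : fderiv ℂ a 0 (Pi.single i 1) ≠ 0) :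
    ∃ Φ Ψ : (Fin n → ℂ) → (Fin n → ℂ), AnalyticAt ℂ Φ 0 ∧ AnalyticAt ℂ Ψ 0 ∧
      Φ 0 = 0 ∧ Ψ 0 = 0 ∧ (∀ᶠ x in 𝓝 0, Ψ (Φ x) = x) ∧ (∀ᶠ y in 𝓝 0, Φ (Ψ y) = y) ∧
      ∀ x, Φ x i = a x := by
  set Φ : (Fin n → ℂ) → (Fin n → ℂ) := fun x => dropCoord i x + a x • Pi.single i 1 with hΦ
  have hΦan : AnalyticAt ℂ Φ 0 :=
    ((dropCoord i).analyticAt 0).add (ha.smul analyticAt_const)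
  have hΦ0 : Φ 0 = 0 := by simp [hΦ, ha0]
  set D : (Fin n → ℂ) →L[ℂ] (Fin n → ℂ) :=
    dropCoord i + (fderiv ℂ a 0).smulRight (Pi.single i 1) with hD
  have hD' : HasStrictFDerivAt Φ D 0 :=
    (dropCoord i).hasStrictFDerivAt.add (ha.hasStrictFDerivAt.smul_const _)
  have hinj : Function.Injective D := by
    rw [injective_iff_map_eq_zero]
    intro v hv
    have hne : ∀ j, j ≠ i → v j = 0 := fun j hj => by
      simpa [hD, dropCoord_of_ne hj, hj] using congrFun hv j
    have hv' : v = v i • Pi.single i 1 := by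
      ext j
      by_cases h : j = i
      · subst h; simp
      · simp [hne j h, h]
    have h1 : fderiv ℂ a 0 v = 0 := by
      simpa [hD, dropCoord_self] using congrFun hv i
    rw [hv', map_smul, smul_eq_mul] at h1
    rw [hv', (mul_eq_zero.1 h1).resolve_right hi, zero_smul]
  set e : (Fin n → ℂ) ≃L[ℂ] (Fin n → ℂ) :=
    (LinearEquiv.ofInjectiveEndo D.toLinearMap hinj).toContinuousLinearEquiv with he
  have heD : (e : (Fin n → ℂ) →L[ℂ] (Fin n → ℂ)) = D := by ext1 v; rfl
  have hs : HasStrictFDerivAt Φ (e : (Fin n → ℂ) →L[ℂ] (Fin n → ℂ)) 0 := heD ▸ hD'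
  have hright := hs.eventually_right_inverse
  have hΨ0 := hs.localInverse_apply_image
  have hΨan : AnalyticAt ℂ (hs.localInverse Φ e 0) (Φ 0) :=
    (hs.toOpenPartialHomeomorph Φ).analyticAt_symm' hs.mem_toOpenPartialHomeomorph_source
      hΦan hs.hasFDerivAt.fderiv
  rw [hΦ0] at hright hΨ0 hΨan
  exact ⟨Φ, hs.localInverse Φ e 0, hΦan, hΨan, hΦ0, hΨ0, hs.eventually_left_inverse, hright,
    fun x => by simp [hΦ, dropCoord_self]⟩

/-- A germ of multiplicity one is prime: in suitable coordinates it is a coordinate function `x_i`,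
and `x_i` divides exactly the germs that vanish on the hyperplane `x_i = 0`. -/
theorem prime_of_isUnit_pderiv {a : HolGerm n} (ha0 : evalZero a = 0) {i : Fin n}
    (hi : IsUnit (pderiv i a)) : Prime a := by
  refine ⟨?_, fun h => isUnit_iff_evalZero_ne_zero.1 h ha0, fun u v huv => ?_⟩
  · rintro rfl
    rw [pderiv_zero] at hi
    exact not_isUnit_zero hi
  obtain ⟨w, hw⟩ := huv
  obtain ⟨a, ha, rfl⟩ := HolGerm.exists_rep a
  obtain ⟨w, hwa, rfl⟩ := HolGerm.exists_rep w
  obtain ⟨u, hu, rfl⟩ := HolGerm.exists_rep u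
  obtain ⟨v, hv, rfl⟩ := HolGerm.exists_rep v
  obtain ⟨hpa, hpd⟩ := pderiv_mk i ha
  rw [hpd, isUnit_iff_evalZero_ne_zero, evalZero_mk] at hi
  obtain ⟨Φ, Ψ, hΦ, hΨ, hΦ0, hΨ0, hleft, hright, hcoord⟩ := exists_local_coordinates ha ha0 hi
  have hΨt : Tendsto Ψ (𝓝 0) (𝓝 0) := by simpa [ContinuousAt, hΨ0] using hΨ.continuousAt
  have hΦt : Tendsto Φ (𝓝 0) (𝓝 0) := by simpa [ContinuousAt, hΦ0] using hΦ.continuousAt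
  have hπt : Tendsto (dropCoord i) (𝓝 0) (𝓝 0) := by
    simpa using (dropCoord i).continuous.tendsto 0
  have hcomp : ∀ {f : (Fin n → ℂ) → ℂ}, AnalyticAt ℂ f 0 → AnalyticAt ℂ (f ∘ Ψ) 0 :=
    fun hf => (hΨ0.symm ▸ hf : AnalyticAt ℂ _ (Ψ 0)).comp hΨ
  have hcompπ : ∀ {f : (Fin n → ℂ) → ℂ}, AnalyticAt ℂ f 0 →
      AnalyticAt ℂ (f ∘ Ψ ∘ dropCoord i) 0 := fun {f} hf => by
    have h : AnalyticAt ℂ (f ∘ Ψ) (dropCoord i 0) := by simpa using hcomp hf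
    exact h.comp ((dropCoord i).analyticAt 0)
  have hdvd : ∀ {f : (Fin n → ℂ) → ℂ} (hf : AnalyticAt ℂ f 0),
      HolGerm.mk _ (hcompπ hf) = 0 → HolGerm.mk a ha ∣ HolGerm.mk f hf := by
    intro f hf h
    obtain ⟨g, hg, hfg⟩ := exists_coord_mul_eq_sub_dropCoord i (hcomp hf)
    refine ⟨HolGerm.mk (g ∘ Φ) ((hΦ0.symm ▸ hg : AnalyticAt ℂ g (Φ 0)).comp hΦ), ?_⟩
    rw [HolGerm.mk_mul_mk, HolGerm.mk_eq_mk]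
    filter_upwards [hleft, hΦt.eventually hfg, hΦt.eventually (HolGerm.mk_eq_zero.1 h)]
      with x h1 h2 h3
    simp only [Function.comp_apply] at h2 h3
    simpa [h1, h3, hcoord] using h2
  rw [HolGerm.mk_mul_mk, HolGerm.mk_mul_mk, HolGerm.mk_eq_mk] at hw
  have hprod : HolGerm.mk _ (hcompπ hu) * HolGerm.mk _ (hcompπ hv) = 0 := by
    rw [HolGerm.mk_mul_mk, HolGerm.mk_eq_zero]
    filter_upwards [hπt.eventually hright, (hΨt.comp hπt).eventually hw] with x h1 h2
    have h3 : a (Ψ (dropCoord i x)) = 0 := by rw [← hcoord, h1, dropCoord_self]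
    simpa [h3] using h2
  exact (mul_eq_zero.1 hprod).imp (hdvd hu) (hdvd hv)

/-! ### Principal Tjurina ideals -/

theorem mem_tjurina_self (g : HolGerm n) : g ∈ tjurina g :=
  ((tjurina_le_iff g _).1 le_rfl).1

theorem pderiv_mem_tjurina (i : Fin n) (g : HolGerm n) : pderiv i g ∈ tjurina g :=
  ((tjurina_le_iff g _).1 le_rfl).2 i

/-- A power of a germ of multiplicity one generates a Tjurina ideal. -/
theorem span_pow_eq_tjurina {a : HolGerm n} {i : Fin n} (hi : IsUnit (pderiv i a)) (k : ℕ) :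
    Ideal.span {a ^ k} = tjurina (a ^ (k + 1)) := by
  apply le_antisymm
  · rw [Ideal.span_singleton_le_iff_mem]
    have hk : IsUnit ((k : HolGerm n) + 1) := by
      rw [isUnit_iff_evalZero_ne_zero]
      simpa using Nat.cast_add_one_ne_zero (R := ℂ) k
    have h := pderiv_mem_tjurina i (a ^ (k + 1))
    rw [pderiv_pow_succ] at h
    exact (Ideal.mul_unit_mem_iff_mem _ (hk.mul hi)).1 h
  · refine (tjurina_le_iff _ _).2 ⟨?_, fun j => ?_⟩
    · exact Ideal.mem_span_singleton.2 (pow_dvd_pow a k.le_succ)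
    · rw [pderiv_pow_succ]
      exact Ideal.mem_span_singleton.2 (dvd_mul_right _ _)

/-- If `g = a p` with `a` a nonunit and `p ≠ 0` a partial derivative of `g`, then `a` has
multiplicity one: otherwise multiplication by `a` would raise the multiplicity of `p` by two, and
differentiation would lower it by one only. -/
theorem exists_isUnit_pderiv_of_pderiv_mul_eq {a p : HolGerm n} {i : Fin n} (hp : p ≠ 0)
    (ha : evalZero a = 0) (h : pderiv i (a * p) = p) : ∃ j, IsUnit (pderiv j a) := by
  by_contra! hne
  have ha2 : a ∈ vanishing 2 := by
    refine mem_vanishing_succ.2 ⟨⟨mem_vanishing_one.2 ha, fun j => mem_vanishing_one.2 ?_⟩, ha⟩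
    simpa [isUnit_iff_evalZero_ne_zero] using hne j
  refine hp (eq_zero_of_forall_mem_vanishing fun k => ?_)
  induction k with
  | zero => trivial
  | succ k ih =>
    have hap := mul_mem_vanishing ha2 ih
    rw [show 2 + k = k + 1 + 1 by omega] at hap
    exact h ▸ (mem_vanishing_succ.1 hap).1.2 i

/-- If `a` is prime of multiplicity one and `p` divides all partial derivatives of `a p`, then `p` is
a power of `a` up to a unit: the part of `p` prime to `a` divides its own partial derivatives. -/
theorem exists_associated_pow_of_dvd_pderiv_mul {a p : HolGerm n} (ha : Prime a)
    (ha0 : evalZero a = 0) (hp : p ≠ 0) (h : ∀ j, p ∣ pderiv j (a * p)) :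
    ∃ s, Associated (a ^ s) p := by
  obtain ⟨q, hpq, haq⟩ :=
    (finiteMultiplicity_of_evalZero_eq_zero ha0 hp).exists_eq_pow_mul_and_not_dvd
  set s := multiplicity a p
  have hq : q ≠ 0 := by rintro rfl; simp at haq
  have hu : IsUnit q := by
    refine isUnit_of_dvd_pderiv hq fun j => ?_
    obtain ⟨b, hb⟩ := h j
    rw [hpq, ← mul_assoc, ← pow_succ', pderiv_mul, pderiv_pow_succ] at hb
    have hc : a * pderiv j q = q * (b - (s + 1) * pderiv j a) := by
      apply mul_left_cancel₀ (pow_ne_zero s ha.ne_zero)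
      linear_combination hb
    obtain ⟨c, hc'⟩ := (ha.dvd_or_dvd ⟨_, hc.symm⟩).resolve_left haq
    refine ⟨c, mul_left_cancel₀ ha.ne_zero ?_⟩
    rw [hc, hc']
    ring
  exact ⟨s, hpq ▸ associated_mul_unit_right _ _ hu⟩

/-- A principal Tjurina ideal other than `0` and the whole ring is generated by a power of a prime
germ of multiplicity one. -/
theorem exists_associated_pow_of_span_eq_tjurina {g h : HolGerm n} (h0 : h ≠ 0)
    (hu : ¬ IsUnit h) (hT : Ideal.span {h} = tjurina g) :
    ∃ a, Prime a ∧ mult a = 1 ∧ ∃ s, Associated (a ^ s) h := by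
  obtain ⟨p, hpS, hph⟩ := exists_mem_span_singleton_eq h0 hT.symm
  have hass : Associated p h := Ideal.span_singleton_eq_span_singleton.1 hph
  have hp0 : p ≠ 0 := hass.ne_zero_iff.2 h0
  have hdvd : ∀ x ∈ tjurina g, p ∣ x := fun x hx =>
    Ideal.mem_span_singleton.1 (hph.trans hT ▸ hx)
  rcases hpS with rfl | ⟨i, rfl⟩
  · exact absurd (hass.isUnit_iff.1
      (isUnit_of_dvd_pderiv hp0 fun i => hdvd _ (pderiv_mem_tjurina i p))) hu
  · set p := pderiv i g with hp
    obtain ⟨a, hga⟩ := hdvd g (mem_tjurina_self g)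
    rw [mul_comm] at hga
    have hpd : ∀ j, p ∣ pderiv j (a * p) := fun j => hga ▸ hdvd _ (pderiv_mem_tjurina j g)
    have ha0 : evalZero a = 0 := by
      by_contra hne
      -- If `a` were a unit, then `g` would divide all its derivatives and generate the ideal.
      have hau := isUnit_iff_evalZero_ne_zero.2 hne
      have hgp : Associated g p := hga ▸ associated_unit_mul_left _ _ hau
      refine hu (hass.isUnit_iff.1 (hgp.isUnit_iff.1 (isUnit_of_dvd_pderiv
        (hgp.ne_zero_iff.2 hp0) fun j => hgp.dvd.trans (hdvd _ (pderiv_mem_tjurina j g)))))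
    obtain ⟨j, hj⟩ := exists_isUnit_pderiv_of_pderiv_mul_eq hp0 ha0 (hga ▸ hp.symm)
    have ha := prime_of_isUnit_pderiv ha0 hj
    obtain ⟨s, hs⟩ := exists_associated_pow_of_dvd_pderiv_mul ha ha0 hp0 hpd
    exact ⟨a, ha, mult_eq_one_iff.2 ⟨ha0, j, hj⟩, s, hs.trans hass⟩

theorem associated_of_irreducible_of_dvd_pow {a f : HolGerm n} (ha : Prime a)
    (hf : Irreducible f) {s : ℕ} (h : f ∣ a ^ s) : Associated f a := by
  obtain ⟨e, -, he⟩ := (dvd_prime_pow ha s).1 h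
  have he0 : e ≠ 0 := by
    rintro rfl
    exact hf.not_isUnit (he.isUnit_iff.2 (by simp))
  exact (ha.irreducible.associated_of_dvd hf ((dvd_pow_self a he0).trans he.symm.dvd)).symm

theorem mult_eq_one_of_associated {a f : HolGerm n} (h : Associated a f) (ha : mult a = 1) :
    mult f = 1 := by
  obtain ⟨u, rfl⟩ := h
  obtain ⟨ha0, i, hi⟩ := mult_eq_one_iff.1 ha
  refine mult_eq_one_iff.2 ⟨by simp [ha0], i, ?_⟩
  rw [isUnit_iff_evalZero_ne_zero] at hi ⊢
  have hu := isUnit_iff_evalZero_ne_zero.1 u.isUnit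
  rw [pderiv_mul, map_add, map_mul, map_mul, ha0, zero_mul, zero_add]
  exact mul_ne_zero hu hi

theorem isTjurinaIdeal_span_pow_iff {f : HolGerm n} (hf : Irreducible f) {k : ℕ} (hk : 1 ≤ k) :
    IsTjurinaIdeal (Ideal.span {f ^ k}) ↔ mult f = 1 := by
  have hk0 : k ≠ 0 := by omega
  refine ⟨fun ⟨g, hg⟩ => ?_, fun h => ?_⟩
  · obtain ⟨a, ha, ha1, s, hs⟩ := exists_associated_pow_of_span_eq_tjurina
      (pow_ne_zero k hf.ne_zero) (fun h => hf.not_isUnit ((isUnit_pow_iff hk0).1 h)) hg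
    exact mult_eq_one_of_associated
      (associated_of_irreducible_of_dvd_pow ha hf ((dvd_pow_self f hk0).trans hs.symm.dvd)).symm ha1
  · obtain ⟨-, i, hi⟩ := mult_eq_one_iff.1 h
    exact ⟨_, span_pow_eq_tjurina hi k⟩

theorem not_isTjurinaIdeal_span_prod_pow {r : ℕ} {f : Fin r → HolGerm n} {k : Fin r → ℕ}
    (hr : 2 ≤ r) (hf : ∀ i, Irreducible (f i)) (hne : ∀ i j, i ≠ j → ¬ Associated (f i) (f j))
    (hk : ∀ i, 1 ≤ k i) : ¬ IsTjurinaIdeal (Ideal.span {∏ i, f i ^ k i}) := by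
  rintro ⟨g, hg⟩
  have hdvd : ∀ i, f i ∣ ∏ i, f i ^ k i := fun i =>
    (dvd_pow_self (f i) (by have := hk i; omega)).trans
      (Finset.dvd_prod_of_mem (fun i => f i ^ k i) (Finset.mem_univ i))
  obtain ⟨a, ha, -, s, hs⟩ := exists_associated_pow_of_span_eq_tjurina
    (Finset.prod_ne_zero_iff.2 fun i _ => pow_ne_zero (k i) (hf i).ne_zero)
    (fun h => (hf ⟨0, by omega⟩).not_isUnit (isUnit_of_dvd_unit (hdvd _) h)) hg
  have hass : ∀ i, Associated (f i) a := fun i =>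
    associated_of_irreducible_of_dvd_pow ha (hf i) ((hdvd i).trans hs.symm.dvd)
  exact hne ⟨0, by omega⟩ ⟨1, by omega⟩ (by simp) ((hass _).trans (hass _).symm)

theorem tjurinaOfIdeal_antideriv_le (I : Ideal (HolGerm n)) :
    tjurinaOfIdeal (antideriv I) ≤ I :=
  iSup₂_le fun _ hg => hg

theorem IsTjurinaIdeal.isTFull {I : Ideal (HolGerm n)} (h : IsTjurinaIdeal I) : IsTFull I := by
  obtain ⟨g, rfl⟩ := h
  exact le_antisymm (le_iSup₂_of_le (f := fun g' (_ : g' ∈ antideriv (tjurina g)) => tjurina g')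
    g (le_refl (tjurina g)) le_rfl) (tjurinaOfIdeal_antideriv_le _)

/-- A principal `T`-full ideal is generated by a single element of some `T(g)` with `g ∈ Δ(I)`, as
the ring is local, and is therefore equal to that `T(g)`. -/
theorem IsTFull.isTjurinaIdeal {I : Ideal (HolGerm n)} (hI : I.IsPrincipal) (h : IsTFull I) :
    IsTjurinaIdeal I := by
  obtain ⟨x, rfl⟩ := hI
  change IsTFull (Ideal.span {x}) at h
  change IsTjurinaIdeal (Ideal.span {x})
  by_cases hx : x = 0
  · subst hx
    refine ⟨0, le_antisymm (by simp) ((tjurina_le_iff _ _).2 ⟨zero_mem _, fun i => ?_⟩)⟩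
    rw [pderiv_zero]
    exact zero_mem _
  · have hspan : Ideal.span (⋃ g ∈ antideriv (Ideal.span {x}), (tjurina g : Set (HolGerm n))) =
        Ideal.span {x} := by
      conv_rhs => rw [h]
      simp only [Ideal.span_iUnion, Ideal.span_eq]
      rfl
    obtain ⟨s, hs, hsx⟩ := exists_mem_span_singleton_eq hx hspan
    simp only [Set.mem_iUnion] at hs
    obtain ⟨g, hg, hsg⟩ := hs
    refine ⟨g, le_antisymm ?_ hg⟩
    rw [← hsx]
    exact (Ideal.span_singleton_le_iff_mem _).2 hsg

end TjurinaIdeals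

end

theorem mainTheorem2 (n : ℕ) (hn : 2 ≤ n) :
    (∀ (f : TjurinaIdeals.HolGerm n) (k : ℕ), Irreducible f → 1 ≤ k →
      (TjurinaIdeals.IsTjurinaIdeal (Ideal.span {f ^ k}) ↔ TjurinaIdeals.mult f = 1)) ∧
    (∀ (r : ℕ) (f : Fin r → TjurinaIdeals.HolGerm n) (k : Fin r → ℕ), 2 ≤ r →
      (∀ i, Irreducible (f i)) → (∀ i j, i ≠ j → ¬ Associated (f i) (f j)) → (∀ i, 1 ≤ k i) →
      ¬ TjurinaIdeals.IsTjurinaIdeal (Ideal.span {∏ i, f i ^ k i})) ∧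
    (∀ I : Ideal (TjurinaIdeals.HolGerm n), Submodule.IsPrincipal I →
      (TjurinaIdeals.IsTjurinaIdeal I ↔ TjurinaIdeals.IsTFull I)) :=
  ⟨fun _ _ hf hk => TjurinaIdeals.isTjurinaIdeal_span_pow_iff hf hk,
    fun _ _ _ hr hf hne hk => TjurinaIdeals.not_isTjurinaIdeal_span_prod_pow hr hf hne hk,
    fun _ hI => ⟨fun h => h.isTFull, fun h => h.isTjurinaIdeal hI⟩⟩
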